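/- Let $k$ be an algebraically closed field of characteristic zero and let $H$ be a Hopf algebra over $k$, with comultiplication $\Delta(h)=\sum h_1\otimes h_2$ and antipode $S$, which is semisimple as an algebra. A Hopf subalgebra of $H$ is a unital subalgebra $B\subseteq H$ with $\Delta(B)\subseteq B\otimes B$ and $S(B)\subseteq B$; it is a Hopf algebra under the restricted structure maps. It is called normal if $\sum h_1\,b\,S(h_2)\in B$ and $\sum S(h_1)\,b\,h_2\in B$ for all $h\in H$ and $b\in B$. Let $A$ and $L$ be normal Hopf subalgebras of $H$ such that $H=AL$ (that is, $H$ is the linear span of the products $al$ with $a\in A$, $l\in L$) and $A\cap L=k\cdot 1_H$. Then the multiplication map $A\otimes_k L\to H$, $a\otimes l\mapsto al$, is an isomorphism of Hopf algebras. -/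

import Mathlib

open scoped TensorProduct

/-- A Hopf subalgebra of a Hopf algebra `H`: a unital subalgebra `A` with `Δ(A) ⊆ A ⊗ A`
(the image of `A ⊗ A` in `H ⊗ H`) and `S(A) ⊆ A`. -/
structure HopfSubalgebra (k H : Type*) [Field k] [Ring H] [HopfAlgebra k H] extends
    Subalgebra k H where
  comul_mem : ∀ a ∈ toSubalgebra, Coalgebra.comul (R := k) a ∈
    (Algebra.TensorProduct.map toSubalgebra.val toSubalgebra.val).range
  antipode_mem : ∀ a ∈ toSubalgebra, HopfAlgebra.antipode k a ∈ toSubalgebra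

namespace HopfSubalgebra

noncomputable section

variable {k H : Type*} [Field k] [Ring H] [HopfAlgebra k H] (A : HopfSubalgebra k H)

theorem map_val_injective :
    Function.Injective (Algebra.TensorProduct.map A.toSubalgebra.val A.toSubalgebra.val) :=
  TensorProduct.map_injective_of_flat_flat A.toSubalgebra.val.toLinearMap
    A.toSubalgebra.val.toLinearMap Subtype.val_injective Subtype.val_injective

theorem map_map_val_injective :
    Function.Injective (Algebra.TensorProduct.map A.toSubalgebra.val
      (Algebra.TensorProduct.map A.toSubalgebra.val A.toSubalgebra.val)) :=
  TensorProduct.map_injective_of_flat_flat A.toSubalgebra.val.toLinearMap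
    (Algebra.TensorProduct.map A.toSubalgebra.val A.toSubalgebra.val).toLinearMap
    Subtype.val_injective A.map_val_injective

/-- The restriction `A → A ⊗ A` of the comultiplication of `H`. -/
def comulAux : A.toSubalgebra →ₐ[k] A.toSubalgebra ⊗[k] A.toSubalgebra :=
  ((AlgEquiv.ofInjective _ A.map_val_injective).symm : _ →ₐ[k] _).comp
    (((Bialgebra.comulAlgHom k H).comp A.toSubalgebra.val).codRestrict _
      fun a => A.comul_mem a a.2)

theorem map_val_comulAux (a : A.toSubalgebra) :
    Algebra.TensorProduct.map A.toSubalgebra.val A.toSubalgebra.val (A.comulAux a) =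
      Coalgebra.comul (R := k) (a : H) :=
  congrArg Subtype.val ((AlgEquiv.ofInjective _ A.map_val_injective).apply_symm_apply
    ⟨Coalgebra.comul (R := k) (a : H), A.comul_mem a a.2⟩)

/-- The restriction `A → k` of the counit of `H`. -/
def counitAux : A.toSubalgebra →ₐ[k] k :=
  (Bialgebra.counitAlgHom k H).comp A.toSubalgebra.val

/-- The restriction `A → A` of the antipode of `H`. -/
def antipodeAux : A.toSubalgebra →ₗ[k] A.toSubalgebra :=
  ((HopfAlgebra.antipode k).comp A.toSubalgebra.val.toLinearMap).codRestrict
    (Subalgebra.toSubmodule A.toSubalgebra) fun a => A.antipode_mem a a.2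

/-- A Hopf subalgebra is a bialgebra with the restricted structure maps. -/
instance instBialgebra : Bialgebra k A.toSubalgebra :=
  Bialgebra.ofAlgHom A.comulAux A.counitAux
    (by
      refine AlgHom.ext fun a => A.map_map_val_injective ?_
      have h1 : ((Algebra.TensorProduct.map A.toSubalgebra.val
          (Algebra.TensorProduct.map A.toSubalgebra.val A.toSubalgebra.val)).comp
          ((Algebra.TensorProduct.assoc k k k A.toSubalgebra A.toSubalgebra
            A.toSubalgebra).toAlgHom.comp
            (Algebra.TensorProduct.map A.comulAux (.id k _)))) =
          ((Algebra.TensorProduct.assoc k k k H H H).toAlgHom.comp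
            (Algebra.TensorProduct.map (Bialgebra.comulAlgHom k H) (.id k H))).comp
            (Algebra.TensorProduct.map A.toSubalgebra.val A.toSubalgebra.val) := by
        have e : (Algebra.TensorProduct.map A.toSubalgebra.val
          (Algebra.TensorProduct.map A.toSubalgebra.val A.toSubalgebra.val)).comp
          (Algebra.TensorProduct.assoc k k k A.toSubalgebra A.toSubalgebra
            A.toSubalgebra).toAlgHom = (Algebra.TensorProduct.assoc k k k H H H).toAlgHom.comp
            (Algebra.TensorProduct.map (Algebra.TensorProduct.map A.toSubalgebra.val
              A.toSubalgebra.val) A.toSubalgebra.val) := by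
          ext <;> simp [Algebra.TensorProduct.one_def]
        rw [← AlgHom.comp_assoc, e]
        ext x
        · simp [A.map_val_comulAux]
        · simp
      have h2 : ((Algebra.TensorProduct.map A.toSubalgebra.val
          (Algebra.TensorProduct.map A.toSubalgebra.val A.toSubalgebra.val)).comp
            (Algebra.TensorProduct.map (.id k _) A.comulAux)) =
            (Algebra.TensorProduct.map (.id k H) (Bialgebra.comulAlgHom k H)).comp
            (Algebra.TensorProduct.map A.toSubalgebra.val A.toSubalgebra.val) := by
        ext x
        · simp
        · simp [A.map_val_comulAux]
      have e1 := DFunLike.congr_fun h1 (A.comulAux a)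
      have e2 := DFunLike.congr_fun h2 (A.comulAux a)
      simp only [AlgHom.comp_apply, map_val_comulAux] at e1 e2 ⊢
      rw [e1, e2]
      exact Coalgebra.coassoc_apply (R := k) (a : H))
    (by
      refine AlgHom.ext fun a => ?_
      apply (Algebra.TensorProduct.lid k A.toSubalgebra).injective
      apply Subtype.val_injective
      have h : A.toSubalgebra.val.comp
          (((Algebra.TensorProduct.lid k A.toSubalgebra) : _ →ₐ[k] _).comp
          (Algebra.TensorProduct.map A.counitAux (.id k _))) =
          ((Algebra.TensorProduct.lid k H : _ →ₐ[k] H).comp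
            (Algebra.TensorProduct.map (Bialgebra.counitAlgHom k H) (.id k H))).comp
            (Algebra.TensorProduct.map A.toSubalgebra.val A.toSubalgebra.val) := by
        ext <;> simp [counitAux]
      have e := DFunLike.congr_fun h (A.comulAux a)
      simp only [AlgHom.comp_apply, map_val_comulAux] at e ⊢
      refine e.trans ?_
      have := Coalgebra.rTensor_counit_comul (R := k) (a : H)
      exact (congrArg (Algebra.TensorProduct.lid k H) this).trans (by simp))
    (by
      refine AlgHom.ext fun a => ?_
      apply (Algebra.TensorProduct.rid k k A.toSubalgebra).injective
      apply Subtype.val_injective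
      have h : A.toSubalgebra.val.comp
          (((Algebra.TensorProduct.rid k k A.toSubalgebra) : _ →ₐ[k] _).comp
          (Algebra.TensorProduct.map (.id k _) A.counitAux)) =
          ((Algebra.TensorProduct.rid k k H : _ →ₐ[k] H).comp
            (Algebra.TensorProduct.map (.id k H) (Bialgebra.counitAlgHom k H))).comp
            (Algebra.TensorProduct.map A.toSubalgebra.val A.toSubalgebra.val) := by
        ext <;> simp [counitAux]
      have e := DFunLike.congr_fun h (A.comulAux a)
      simp only [AlgHom.comp_apply, map_val_comulAux] at e ⊢
      refine e.trans ?_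
      have := Coalgebra.lTensor_counit_comul (R := k) (a : H)
      exact (congrArg (Algebra.TensorProduct.rid k k H) this).trans (by simp))

theorem map_val_comul (a : A.toSubalgebra) :
    TensorProduct.map A.toSubalgebra.val.toLinearMap A.toSubalgebra.val.toLinearMap
      (Coalgebra.comul (R := k) a) = Coalgebra.comul (R := k) (a : H) :=
  A.map_val_comulAux a

theorem counit_coe (a : A.toSubalgebra) :
    Coalgebra.counit (R := k) a = Coalgebra.counit (R := k) (a : H) :=
  rfl

/-- A Hopf subalgebra is a Hopf algebra with the restricted structure maps. -/
instance instHopfAlgebra : HopfAlgebra k A.toSubalgebra where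
  antipode := A.antipodeAux
  mul_antipode_rTensor_comul := by
    refine LinearMap.ext fun a => Subtype.val_injective ?_
    have h : A.toSubalgebra.val.toLinearMap ∘ₗ LinearMap.mul' k A.toSubalgebra ∘ₗ
        A.antipodeAux.rTensor A.toSubalgebra =
        (LinearMap.mul' k H ∘ₗ (HopfAlgebra.antipode k).rTensor H) ∘ₗ
        TensorProduct.map A.toSubalgebra.val.toLinearMap A.toSubalgebra.val.toLinearMap := by
      ext x y
      rfl
    have e := DFunLike.congr_fun h (Coalgebra.comul (R := k) a)
    simp only [LinearMap.comp_apply, map_val_comul] at e ⊢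
    exact e.trans (HopfAlgebra.mul_antipode_rTensor_comul_apply (a : H))
  mul_antipode_lTensor_comul := by
    refine LinearMap.ext fun a => Subtype.val_injective ?_
    have h : A.toSubalgebra.val.toLinearMap ∘ₗ LinearMap.mul' k A.toSubalgebra ∘ₗ
        A.antipodeAux.lTensor A.toSubalgebra =
        (LinearMap.mul' k H ∘ₗ (HopfAlgebra.antipode k).lTensor H) ∘ₗ
        TensorProduct.map A.toSubalgebra.val.toLinearMap A.toSubalgebra.val.toLinearMap := by
      ext x y
      rfl
    have e := DFunLike.congr_fun h (Coalgebra.comul (R := k) a)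
    simp only [LinearMap.comp_apply, map_val_comul] at e ⊢
    exact e.trans (HopfAlgebra.mul_antipode_lTensor_comul_apply (a : H))

theorem coe_antipode (a : A.toSubalgebra) :
    (HopfAlgebra.antipode k a : H) = HopfAlgebra.antipode k (a : H) :=
  rfl

variable (k) in
/-- The left adjoint action `h ↦ h₁ a S(h₂)` on a fixed `a`, as a linear map in `h`. -/
def leftAd (a : H) : H →ₗ[k] H :=
  LinearMap.mul' k H ∘ₗ
    TensorProduct.map (LinearMap.mulRight k a) (HopfAlgebra.antipode k) ∘ₗ Coalgebra.comul

variable (k) in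
/-- The right adjoint action `h ↦ S(h₁) a h₂` on a fixed `a`, as a linear map in `h`. -/
def rightAd (a : H) : H →ₗ[k] H :=
  LinearMap.mul' k H ∘ₗ
    TensorProduct.map (HopfAlgebra.antipode k) (LinearMap.mulLeft k a) ∘ₗ Coalgebra.comul

/-- `A` is normal if `h₁ A S(h₂) ⊆ A` and `S(h₁) A h₂ ⊆ A` for all `h ∈ H`. -/
def IsNormal : Prop :=
  ∀ a ∈ A.toSubalgebra, ∀ h : H,
    leftAd k a h ∈ A.toSubalgebra ∧ rightAd k a h ∈ A.toSubalgebra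

end

end HopfSubalgebra

/-!
For `a ∈ A` and `l ∈ L`, the element `a₁ l₁ S(a₂) S(l₂)` lies in `A` and in `L` by normality, hence
is a scalar. As in the case of groups, this forces `A` and `L` to commute elementwise, so that
multiplication is a surjective bialgebra map `π : A ⊗ L → H`.

If `H` is semisimple, a complement of the augmentation ideal provides a nonzero left integral `t`.
As `H` is simple as a Hopf module over itself, the orbit of `t` under the dual of `H` is all of `H`.
Hence `H` is finite-dimensional, and it has a nonzero left cointegral `λ`. Simplicity also shows
that the form `(x, y) ↦ λ(x y)` of a nonzero left cointegral is nondegenerate.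

For `a ∈ A` and `l ∈ L`, the element `∑ λ(a l₂) l₁ = ∑ λ(a₂ l) S(a₁)` lies in `A ∩ L`, hence is a
scalar. It follows that `λ ∘ π` is a left cointegral on `A ⊗ L`. The kernel of `π` lies in the
radical of its form, so `π` is injective.
-/

noncomputable section

open Coalgebra HopfAlgebra WithConv

section Coalgebra

variable {R C D : Type*} [CommSemiring R] [AddCommMonoid C] [Module R C] [Coalgebra R C]
  [AddCommMonoid D] [Module R D] [Coalgebra R D]

/-- The left hit action `f ⇀ x = x₁ f(x₂)` of the dual of a coalgebra. -/
def leftHit (f : Module.Dual R C) : C →ₗ[R] C :=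
  (TensorProduct.rid R C).toLinearMap ∘ₗ f.lTensor C ∘ₗ comul

/-- The right hit action `x ↼ f = f(x₁) x₂` of the dual of a coalgebra. It is bundled as a bilinear
map because the orbit map `f ↦ t ↼ f` of a fixed `t` is studied below. -/
def rightHit : Module.Dual R C →ₗ[R] C →ₗ[R] C :=
  LinearMap.mk₂ R (fun f x => TensorProduct.lid R C (f.rTensor C (comul x)))
    (fun f g x => by simp [LinearMap.rTensor_add]) (fun c f x => by simp [LinearMap.rTensor_smul])
    (fun f x y => by simp) (fun c f x => by simp)

theorem leftHit_apply (f : Module.Dual R C) {x : C} {ι : Type*} (r : Repr R x ι) :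
    leftHit f x = ∑ i ∈ r.index, f (r.right i) • r.left i := by
  simp [leftHit, ← r.eq]

theorem rightHit_apply (f : Module.Dual R C) {x : C} {ι : Type*} (r : Repr R x ι) :
    rightHit f x = ∑ i ∈ r.index, f (r.left i) • r.right i := by
  simp [rightHit, ← r.eq]

@[simp]
theorem leftHit_counit (x : C) : leftHit (counit (R := R)) x = x := by
  simp [leftHit]

@[simp]
theorem rightHit_counit (x : C) : rightHit (counit (R := R)) x = x := by
  simp [rightHit]

theorem apply_rightHit (f g : Module.Dual R C) (x : C) : g (rightHit f x) = f (leftHit g x) := by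
  simp [leftHit_apply g (ℛ R x), rightHit_apply f (ℛ R x), mul_comm]

@[simp]
theorem counit_leftHit (f : Module.Dual R C) (x : C) : counit (R := R) (leftHit f x) = f x := by
  rw [← apply_rightHit, rightHit_counit]

theorem rightHit_rightHit (f g : Module.Dual R C) (x : C) :
    rightHit g (rightHit f x) = rightHit (g ∘ₗ rightHit f) x := by
  have hcoassoc := sum_tmul_tmul_eq (ℛ R x) (fun i => ℛ R _) (fun i => ℛ R _)
  have := congr(TensorProduct.lift (LinearMap.lsmul R _ ∘ₗ f)
    ((TensorProduct.lift (LinearMap.lsmul R C ∘ₗ g)).lTensor C $hcoassoc))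
  simp only [rightHit_apply f (ℛ R x), rightHit_apply (g ∘ₗ _) (ℛ R x), map_sum, map_smul,
    LinearMap.comp_apply]
  simp only [rightHit_apply _ (ℛ R _)]
  simpa [Finset.smul_sum, Finset.sum_smul, smul_smul, mul_comm] using this.symm

theorem map_leftHit (φ : C →ₗc[R] D) (f : Module.Dual R D) (x : C) :
    φ (leftHit (f ∘ₗ φ) x) = leftHit f (φ x) := by
  simp [leftHit_apply _ (ℛ R x), leftHit_apply f ((ℛ R x).induced φ)]

theorem sum_counit_mul_counit {x : C} {ι : Type*} (r : Repr R x ι) :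
    ∑ i ∈ r.index, counit (R := R) (r.left i) * counit (R := R) (r.right i) =
      counit (R := R) x := by
  simpa using congr(counit (R := R) $(sum_counit_smul r))

theorem leftHit_tmul (f : Module.Dual R (C ⊗[R] D)) {c : C} (d : D) {ι : Type*} (r : Repr R c ι) :
    leftHit f (c ⊗ₜ[R] d) =
      ∑ i ∈ r.index, r.left i ⊗ₜ[R] leftHit (f ∘ₗ TensorProduct.mk R C D (r.right i)) d := by
  simpa [leftHit, TensorProduct.comul_tmul, ← r.eq, ← (ℛ R d).eq, TensorProduct.sum_tmul,
    TensorProduct.tmul_sum, TensorProduct.tmul_smul] using Finset.sum_comm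

end Coalgebra

section HopfAlgebra

variable {R H : Type*} [CommSemiring R] [Semiring H] [HopfAlgebra R H]

theorem sum_antipode_tmul_one_mul_comul {h : H} {ι : Type*} (r : Repr R h ι) :
    ∑ i ∈ r.index, (antipode R (r.left i) ⊗ₜ[R] (1 : H)) * comul (R := R) (r.right i) =
      1 ⊗ₜ[R] h := by
  have hcoassoc := sum_tmul_tmul_eq r (fun i => ℛ R _) (fun i => ℛ R _)
  have hcontract := congr(((LinearMap.mul' R H).rTensor H ∘ₗ
    (TensorProduct.assoc R H H H).symm.toLinearMap ∘ₗ (antipode R).rTensor (H ⊗[R] H)) $hcoassoc)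
  simp only [map_sum, LinearMap.comp_apply, LinearMap.rTensor_tmul, LinearEquiv.coe_coe,
    TensorProduct.assoc_symm_tmul, LinearMap.mul'_apply, ← TensorProduct.sum_tmul,
    sum_antipode_mul_eq_smul, TensorProduct.smul_tmul] at hcontract
  rw [← TensorProduct.tmul_sum, sum_counit_smul] at hcontract
  rw [hcontract]
  refine Finset.sum_congr rfl fun i _ => ?_
  rw [← (ℛ R (r.right i)).eq, Finset.mul_sum]
  simp

theorem one_tmul_mul_comul {s : H} (n : H) {ι : Type*} (r : Repr R s ι) :
    (1 ⊗ₜ[R] s) * comul (R := R) n =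
      ∑ i ∈ r.index, (antipode R (r.left i) ⊗ₜ[R] 1) * comul (R := R) (r.right i * n) := by
  simp only [← sum_antipode_tmul_one_mul_comul r, Finset.sum_mul, mul_assoc, Bialgebra.comul_mul]

theorem leftHit_comp_mulLeft (f : Module.Dual R H) {s : H} (n : H) {ι : Type*} (r : Repr R s ι) :
    leftHit (f ∘ₗ LinearMap.mulLeft R s) n =
      ∑ i ∈ r.index, antipode R (r.left i) * leftHit f (r.right i * n) := by
  have hcontract := congr(TensorProduct.rid R H (f.lTensor H $(one_tmul_mul_comul n r)))
  rw [← (ℛ R n).eq] at hcontract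
  simp only [map_sum, ← (ℛ R (_ * n)).eq, Finset.mul_sum] at hcontract
  simpa [leftHit_apply _ (ℛ R _), Finset.mul_sum] using hcontract

theorem mul_rightHit (f : Module.Dual R H) {s : H} (n : H) {ι : Type*} (r : Repr R s ι) :
    s * rightHit f n = ∑ i ∈ r.index,
      rightHit (f ∘ₗ LinearMap.mulLeft R (antipode R (r.left i))) (r.right i * n) := by
  have hcontract := congr(TensorProduct.lid R H (f.rTensor H $(one_tmul_mul_comul n r)))
  rw [← (ℛ R n).eq] at hcontract
  simp only [map_sum, ← (ℛ R (_ * n)).eq, Finset.mul_sum] at hcontract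
  simpa [rightHit_apply _ (ℛ R _), Finset.mul_sum] using hcontract

end HopfAlgebra

section SubHopfModule

theorem exists_repr_forall_right_eq_rightHit {R C : Type*} [CommSemiring R] [AddCommMonoid C]
    [Module R C] [Coalgebra R C] [Module.Free R C] (x : C) :
    ∃ r : Repr R x (Module.Free.ChooseBasisIndex R C), ∀ i, ∃ f : Module.Dual R C,
      r.right i = rightHit f x := by
  let b := Module.Free.chooseBasis R C
  let e := TensorProduct.equivFinsuppOfBasisLeft (N := C) b
  refine ⟨⟨(e (comul x)).support, b, e (comul x), ?_⟩,
    fun i => ⟨b.coord i, TensorProduct.equivFinsuppOfBasisLeft_apply b (comul x) i⟩⟩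
  exact (TensorProduct.equivFinsuppOfBasisLeft_symm_apply b (e (comul x))).symm.trans
    (e.symm_apply_apply (comul x))

theorem finite_of_surjective_rightHit_flip {R C : Type*} [CommSemiring R] [AddCommMonoid C]
    [Module R C] [Coalgebra R C] {t : C} (h : Function.Surjective (rightHit (R := R).flip t)) :
    Module.Finite R C := by
  classical
  refine ⟨(ℛ R t).index.image (ℛ R t).right, eq_top_iff.2 fun x _ => ?_⟩
  obtain ⟨f, rfl⟩ := h x
  rw [LinearMap.flip_apply, rightHit_apply f (ℛ R t)]
  exact sum_mem fun i hi =>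
    Submodule.smul_mem _ _ (Submodule.subset_span (Finset.mem_image_of_mem _ hi))

variable {k H : Type*} [Field k] [Ring H] [HopfAlgebra k H]

/-- Stability under the right hit action makes `Y` a subcomodule, so this is the simplicity of `H`
as a Hopf module over itself. -/
theorem eq_bot_or_eq_top_of_mul_mem_of_rightHit_mem (Y : Submodule k H)
    (hmul : ∀ h, ∀ y ∈ Y, h * y ∈ Y) (hhit : ∀ f : Module.Dual k H, ∀ y ∈ Y, rightHit f y ∈ Y) :
    Y = ⊥ ∨ Y = ⊤ := by
  by_cases hcounit : ∀ y ∈ Y, counit (R := k) y = 0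
  · refine .inl ((Submodule.eq_bot_iff _).2 fun y hy => ?_)
    rw [← Module.forall_dual_apply_eq_zero_iff k]
    intro f
    rw [← leftHit_counit (R := k) y, ← apply_rightHit, hcounit _ (hhit f y hy)]
  · push Not at hcounit
    obtain ⟨y, hy, hne⟩ := hcounit
    obtain ⟨r, hr⟩ := exists_repr_forall_right_eq_rightHit (R := k) y
    have hone : counit (R := k) y • (1 : H) ∈ Y := by
      rw [← sum_antipode_mul_eq_smul r]
      refine Y.sum_mem fun i _ => hmul _ _ ?_
      obtain ⟨f, hf⟩ := hr i
      exact hf ▸ hhit f y hy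
    refine .inr (eq_top_iff.2 fun x _ => ?_)
    simpa using hmul x 1 ((Y.smul_mem_iff hne).1 hone)

end SubHopfModule

section Integrals

section Bialgebra

variable {R H : Type*} [CommSemiring R] [Semiring H] [Bialgebra R H]

variable (R) in
/-- `t` is a left integral in `H`: the left multiplications of `H` act on `t` through the counit. -/
def IsLeftIntegral (t : H) : Prop :=
  ∀ h, h * t = counit (R := R) h • t

/-- `lam` is a left cointegral on `H`, that is, a left integral in the dual algebra of `H`:
`x₁ lam(x₂) = lam(x) 1` for all `x`. -/
def IsLeftCointegral (lam : Module.Dual R H) : Prop :=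
  ∀ x, leftHit lam x = lam x • 1

theorem rightHit_one (f : Module.Dual R H) : rightHit f (1 : H) = f 1 • 1 := by
  simp [rightHit, Algebra.TensorProduct.one_def]

end Bialgebra

theorem exists_isLeftIntegral_ne_zero (R H : Type*) [CommRing R] [Nontrivial R] [Ring H]
    [Bialgebra R H] [IsSemisimpleRing H] : ∃ t : H, IsLeftIntegral R t ∧ t ≠ 0 := by
  let I : Submodule H H := RingHom.ker (Bialgebra.counitAlgHom R H)
  have mem_I (x : H) : x ∈ I ↔ counit (R := R) x = 0 := Iff.rfl
  obtain ⟨J, hIJ⟩ := exists_isCompl I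
  obtain ⟨e, he, t, ht, het⟩ := Submodule.mem_sup.1 (hIJ.sup_eq_top ▸ Submodule.mem_top (x := 1))
  refine ⟨t, fun h => ?_, ?_⟩
  · have hmem : (h - algebraMap R H (counit (R := R) h)) * t ∈ I ⊓ J :=
      ⟨(mem_I _).2 (by simp), J.smul_mem _ ht⟩
    rwa [hIJ.inf_eq_bot, Submodule.mem_bot, sub_mul, sub_eq_zero, ← Algebra.smul_def] at hmem
  · rintro rfl
    rw [add_zero] at het
    simp [mem_I, het] at he

section CommSemiring

variable {R H : Type*} [CommSemiring R] [Semiring H] [HopfAlgebra R H]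

theorem IsLeftIntegral.mul_rightHit {t : H} (ht : IsLeftIntegral R t) (h : H)
    (f : Module.Dual R H) :
    h * rightHit f t = rightHit (f ∘ₗ LinearMap.mulLeft R (antipode R h)) t := by
  let Φ : H →ₗ[R] H := rightHit.flip t ∘ₗ (LinearMap.mul R H).compr₂ f ∘ₗ antipode R
  calc h * rightHit f t
      = ∑ i ∈ (ℛ R h).index, counit (R := R) ((ℛ R h).right i) • Φ ((ℛ R h).left i) := by
        simp only [_root_.mul_rightHit f t (ℛ R h), ht _, map_smul]
        rfl
    _ = Φ (leftHit (counit (R := R)) h) := by simp [leftHit_apply _ (ℛ R h)]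
    _ = Φ h := by rw [leftHit_counit]

theorem IsLeftCointegral.leftHit_comp_mulLeft {lam : Module.Dual R H} (hlam : IsLeftCointegral lam)
    {s : H} (n : H) {ι : Type*} (r : Repr R s ι) :
    leftHit (lam ∘ₗ LinearMap.mulLeft R s) n =
      ∑ i ∈ r.index, lam (r.right i * n) • antipode R (r.left i) := by
  simp [_root_.leftHit_comp_mulLeft lam n r, hlam _]

end CommSemiring

variable {k H : Type*} [Field k] [Ring H] [HopfAlgebra k H]

theorem IsLeftIntegral.surjective_rightHit_flip {t : H} (ht : IsLeftIntegral k t) (hne : t ≠ 0) :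
    Function.Surjective (rightHit (R := k).flip t) := by
  rw [← LinearMap.range_eq_top]
  refine (eq_bot_or_eq_top_of_mul_mem_of_rightHit_mem _ ?_ ?_).resolve_left fun hbot => hne ?_
  · rintro h _ ⟨f, rfl⟩
    exact ⟨_, (ht.mul_rightHit h f).symm⟩
  · rintro f _ ⟨g, rfl⟩
    exact ⟨_, (rightHit_rightHit g f t).symm⟩
  · rw [← Submodule.mem_bot k, ← hbot]
    exact ⟨counit, rightHit_counit t⟩

theorem IsLeftIntegral.bijective_rightHit_flip {t : H} (ht : IsLeftIntegral k t) (hne : t ≠ 0) :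
    Function.Bijective (rightHit (R := k).flip t) := by
  have hsurj := ht.surjective_rightHit_flip hne
  have := finite_of_surjective_rightHit_flip hsurj
  exact ⟨(LinearMap.injective_iff_surjective_of_finrank_eq_finrank
    Subspace.dual_finrank_eq).2 hsurj, hsurj⟩

theorem IsLeftIntegral.exists_isLeftCointegral_ne_zero {t : H} (ht : IsLeftIntegral k t)
    (hne : t ≠ 0) : ∃ lam : Module.Dual k H, IsLeftCointegral lam ∧ lam ≠ 0 := by
  let e := LinearEquiv.ofBijective _ (ht.bijective_rightHit_flip hne)
  let lam : Module.Dual k H := Module.Dual.eval k H 1 ∘ₗ e.symm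
  have lam_hit (f : Module.Dual k H) : lam (rightHit f t) = f 1 :=
    congr($(e.symm_apply_apply f) 1)
  refine ⟨lam, fun x => ?_, fun h => ?_⟩
  · obtain ⟨g, rfl⟩ := e.surjective x
    refine Module.eval_apply_injective k (LinearMap.ext fun f => ?_)
    change f (leftHit lam (rightHit g t)) = f (lam (rightHit g t) • 1)
    rw [← apply_rightHit, rightHit_rightHit, lam_hit, lam_hit, LinearMap.comp_apply, rightHit_one]
  · simpa [h] using lam_hit counit

theorem IsLeftCointegral.eq_zero_of_forall_apply_mul_eq_zero {lam : Module.Dual k H}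
    (hlam : IsLeftCointegral lam) (hne : lam ≠ 0) {x : H} (hx : ∀ s, lam (s * x) = 0) : x = 0 := by
  let N : Submodule k H := LinearMap.ker ((LinearMap.mul k H).flip.compr₂ lam)
  have mem_N (y : H) : y ∈ N ↔ ∀ s, lam (s * y) = 0 := LinearMap.ext_iff
  have hN : N = ⊥ := by
    refine (eq_bot_or_eq_top_of_mul_mem_of_rightHit_mem N ?_ ?_).resolve_right fun htop => hne ?_
    · intro h y hy
      rw [mem_N] at hy ⊢
      exact fun s => by rw [← mul_assoc, hy]
    · intro f y hy
      rw [mem_N] at hy ⊢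
      intro s
      rw [← LinearMap.mulLeft_apply (R := k), ← LinearMap.comp_apply, apply_rightHit,
        hlam.leftHit_comp_mulLeft y (ℛ k s)]
      simp [hy]
    · ext y
      simpa using (mem_N y).1 (htop ▸ Submodule.mem_top) 1
  rw [← Submodule.mem_bot k, ← hN, mem_N]
  exact hx

end Integrals

section Convolution

variable {R A B H : Type*} [CommSemiring R] [Semiring A] [Semiring B] [Semiring H]

theorem algHom_comp_antipode_convMul [HopfAlgebra R A] [Algebra R H] (φ : A →ₐ[R] H) :
    toConv (φ.toLinearMap ∘ₗ antipode R) * toConv φ.toLinearMap = 1 := by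
  have h := LinearMap.algHom_comp_convMul_distrib φ (toConv (antipode R)) (toConv LinearMap.id)
  rw [LinearMap.antipode_mul_id] at h
  refine WithConv.ext (h.symm.trans ?_)
  ext
  simp [LinearMap.convOne_def]

theorem convMul_antipode_comp_coalgHom [Bialgebra R A] [HopfAlgebra R H] (φ : A →ₐc[R] H) :
    toConv (φ : A →ₗ[R] H) * toConv (antipode R ∘ₗ (φ : A →ₗ[R] H)) = 1 := by
  have h := LinearMap.convMul_comp_coalgHom_distrib (toConv LinearMap.id) (toConv (antipode R))
    (φ : A →ₗc[R] H)
  rw [LinearMap.id_mul_antipode] at h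
  refine WithConv.ext (h.symm.trans ?_)
  ext
  simp [LinearMap.convOne_def]

theorem map_antipode [HopfAlgebra R A] [HopfAlgebra R H] (φ : A →ₐc[R] H) (x : A) :
    φ (antipode R x) = antipode R (φ x) :=
  congr($(left_inv_eq_right_inv (algHom_comp_antipode_convMul (φ : A →ₐ[R] H))
    (convMul_antipode_comp_coalgHom φ)) x)

theorem eq_mul_of_sum_mul_antipode_eq [HopfAlgebra R A] [Algebra R H] (φ : A →ₐ[R] H)
    {f : A →ₗ[R] H} {c : H} (hf : ∀ x, ∑ i ∈ (ℛ R x).index,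
      f ((ℛ R x).left i) * φ (antipode R ((ℛ R x).right i)) = counit (R := R) x • c) (x : A) :
    f x = c * φ x := by
  have hconv : toConv f * toConv (φ.toLinearMap ∘ₗ antipode R) =
      toConv ((counit (R := R)).smulRight c) :=
    WithConv.ext (LinearMap.ext fun x => ((ℛ R x).convMul_apply _ _).trans (hf x))
  have hx := congr(($hconv * toConv φ.toLinearMap) x)
  rw [mul_assoc, algHom_comp_antipode_convMul, mul_one, (ℛ R x).convMul_apply] at hx
  calc f x = ∑ i ∈ (ℛ R x).index, (counit (R := R) ((ℛ R x).left i) • c) *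
        φ ((ℛ R x).right i) := hx
    _ = c * φ (∑ i ∈ (ℛ R x).index, counit (R := R) ((ℛ R x).left i) • (ℛ R x).right i) := by
      simp [Finset.mul_sum]
    _ = c * φ x := by rw [sum_counit_smul]

/-- The bialgebra map `A ⊗ B → H`, `a ⊗ b ↦ f a * g b`, for bialgebra maps `f : A → H` and
`g : B → H` with commuting images. -/
def tensorLiftBialgHom [Bialgebra R A] [Bialgebra R B] [Bialgebra R H] (f : A →ₐc[R] H)
    (g : B →ₐc[R] H) (hcomm : ∀ a b, Commute (f a) (g b)) : A ⊗[R] B →ₐc[R] H :=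
  let φ : A ⊗[R] B →ₗc[R] H := (Bialgebra.mulCoalgHom R H).comp
    (Coalgebra.TensorProduct.map (f : A →ₗc[R] H) (g : B →ₗc[R] H))
  let ψ := Algebra.TensorProduct.lift (f : A →ₐ[R] H) (g : B →ₐ[R] H) hcomm
  have hφψ : (φ : A ⊗[R] B →ₗ[R] H) = ψ.toLinearMap := by
    ext a b
    exact (Algebra.TensorProduct.lift_tmul (f : A →ₐ[R] H) (g : B →ₐ[R] H) hcomm a b).symm
  BialgHom.ofAlgHom ψ
    (AlgHom.toLinearMap_injective <|
      congr(counit ∘ₗ $(hφψ.symm)).trans φ.counit_comp)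
    (AlgHom.toLinearMap_injective <|
      congr(TensorProduct.map $(hφψ.symm) $(hφψ.symm) ∘ₗ comul).trans <|
        φ.map_comp_comul.trans congr(comul ∘ₗ $hφψ))

theorem tensorLiftBialgHom_tmul [Bialgebra R A] [Bialgebra R B] [Bialgebra R H] (f : A →ₐc[R] H)
    (g : B →ₐc[R] H) (hcomm : ∀ a b, Commute (f a) (g b)) (a : A) (b : B) :
    tensorLiftBialgHom f g hcomm (a ⊗ₜ[R] b) = f a * g b :=
  Algebra.TensorProduct.lift_tmul _ _ hcomm a b

end Convolution

namespace HopfSubalgebra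

variable {k H : Type*} [Field k] [Ring H] [HopfAlgebra k H]

theorem leftAd_apply (x : H) {h : H} {ι : Type*} (r : Repr k h ι) :
    leftAd k x h = ∑ i ∈ r.index, r.left i * x * antipode k (r.right i) := by
  simp [leftAd, ← r.eq]

theorem counit_leftAd (x h : H) :
    counit (R := k) (leftAd k x h) = counit (R := k) h * counit (R := k) x := by
  simp only [leftAd_apply x (ℛ k h), map_sum, Bialgebra.counit_mul, counit_antipode,
    mul_right_comm _ (counit x), ← Finset.sum_mul, sum_counit_mul_counit]

/-- The inclusion of a Hopf subalgebra, as a bialgebra map. -/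
def subtypeBialgHom (A : HopfSubalgebra k H) : A.toSubalgebra →ₐc[k] H :=
  BialgHom.ofAlgHom A.toSubalgebra.val rfl (AlgHom.ext fun a => A.map_val_comul a)

@[simp]
theorem subtypeBialgHom_apply (A : HopfSubalgebra k H) (a : A.toSubalgebra) :
    A.subtypeBialgHom a = (a : H) :=
  rfl

variable {A L : HopfSubalgebra k H}

theorem eq_counit_smul_one_of_mem (hinf : A.toSubalgebra ⊓ L.toSubalgebra = ⊥) {x : H}
    (hA : x ∈ A.toSubalgebra) (hL : x ∈ L.toSubalgebra) : x = counit (R := k) x • 1 := by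
  obtain ⟨c, rfl⟩ := Algebra.mem_bot.1 (hinf ▸ ⟨hA, hL⟩ : x ∈ (⊥ : Subalgebra k H))
  rw [Bialgebra.counit_algebraMap, Algebra.algebraMap_eq_smul_one]

/-- Both sides are the commutator `a₁ l₁ S(a₂) S(l₂)`. -/
theorem sum_leftAd_mul_antipode_eq_sum_mul_leftAd {a l : H} {ι κ : Type*} (r : Repr k a ι)
    (s : Repr k l κ) :
    ∑ j ∈ s.index, leftAd k (s.left j) a * antipode k (s.right j) =
      ∑ i ∈ r.index, r.left i * leftAd k (antipode k (r.right i)) l := by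
  simp only [leftAd_apply _ r, leftAd_apply _ s, Finset.sum_mul, Finset.mul_sum, mul_assoc]
  exact Finset.sum_comm

theorem sum_leftAd_mul_antipode_eq_smul_one (hA : A.IsNormal) (hL : L.IsNormal)
    (hinf : A.toSubalgebra ⊓ L.toSubalgebra = ⊥) (a : A.toSubalgebra) {l : L.toSubalgebra}
    {κ : Type*} (s : Repr k l κ) :
    ∑ j ∈ s.index, leftAd k (s.left j : H) (a : H) * antipode k (s.right j : H) =
      counit (R := k) l • counit (R := k) a • 1 := by
  have hswap := sum_leftAd_mul_antipode_eq_sum_mul_leftAd ((ℛ k a).induced A.subtypeBialgHom)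
    (s.induced L.subtypeBialgHom)
  rw [eq_counit_smul_one_of_mem (k := k) hinf (x := ∑ j ∈ _, _)]
  · simp only [map_sum, Bialgebra.counit_mul, counit_leftAd, counit_antipode, ← counit_coe,
      mul_assoc, ← Finset.mul_sum, sum_counit_mul_counit, smul_comm (counit l), mul_smul]
  · exact hswap ▸ sum_mem fun i _ => mul_mem (Subtype.prop _)
      (hA _ (A.antipode_mem _ (Subtype.prop _)) _).1
  · exact sum_mem fun j _ => mul_mem (hL _ (Subtype.prop _) _).1
      (L.antipode_mem _ (Subtype.prop _))

theorem leftAd_eq_counit_smul (hA : A.IsNormal) (hL : L.IsNormal)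
    (hinf : A.toSubalgebra ⊓ L.toSubalgebra = ⊥) (a : A.toSubalgebra) (l : L.toSubalgebra) :
    leftAd k (l : H) (a : H) = counit (R := k) a • (l : H) := by
  let r := (ℛ k a).induced A.subtypeBialgHom
  let D : H →ₗ[k] H :=
    ∑ i ∈ r.index, LinearMap.mulLeftRight k (r.left i, antipode k (r.right i))
  have hD (x : H) : D x = leftAd k x (a : H) := by simp [D, ← leftAd_apply x r]
  calc leftAd k (l : H) (a : H) = (D ∘ₗ L.toSubalgebra.val.toLinearMap) l := (hD l).symm
    _ = (counit (R := k) a • 1) * (l : H) :=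
      eq_mul_of_sum_mul_antipode_eq L.toSubalgebra.val (fun l => by
        simp only [LinearMap.comp_apply, hD]
        exact sum_leftAd_mul_antipode_eq_smul_one hA hL hinf a (ℛ k l)) l
    _ = counit (R := k) a • (l : H) := by simp

theorem commute_of_isNormal (hA : A.IsNormal) (hL : L.IsNormal)
    (hinf : A.toSubalgebra ⊓ L.toSubalgebra = ⊥) (a : A.toSubalgebra) (l : L.toSubalgebra) :
    Commute (a : H) (l : H) :=
  eq_mul_of_sum_mul_antipode_eq A.toSubalgebra.val
    (f := LinearMap.mulRight k (l : H) ∘ₗ A.toSubalgebra.val.toLinearMap) (fun a =>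
      (leftAd_apply (l : H) ((ℛ k a).induced A.subtypeBialgHom)).symm.trans
        (leftAd_eq_counit_smul hA hL hinf a l)) a

/-- The multiplication map `A ⊗ L → H` of commuting Hopf subalgebras, as a bialgebra map. -/
def mulBialgHom
    (hcomm : ∀ (a : A.toSubalgebra) (l : L.toSubalgebra), Commute (a : H) (l : H)) :
    A.toSubalgebra ⊗[k] L.toSubalgebra →ₐc[k] H :=
  tensorLiftBialgHom A.subtypeBialgHom L.subtypeBialgHom hcomm

section mulBialgHom

variable (hcomm : ∀ (a : A.toSubalgebra) (l : L.toSubalgebra), Commute (a : H) (l : H))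

@[simp]
theorem mulBialgHom_tmul (a : A.toSubalgebra) (l : L.toSubalgebra) :
    mulBialgHom hcomm (a ⊗ₜ[k] l) = (a : H) * (l : H) :=
  tensorLiftBialgHom_tmul _ _ hcomm a l

theorem mulBialgHom_surjective
    (hAL : Subalgebra.toSubmodule A.toSubalgebra * Subalgebra.toSubmodule L.toSubalgebra = ⊤) :
    Function.Surjective (mulBialgHom hcomm) := by
  intro x
  have hx : x ∈ Subalgebra.toSubmodule A.toSubalgebra * Subalgebra.toSubmodule L.toSubalgebra :=
    hAL ▸ Submodule.mem_top
  induction hx using Submodule.mul_induction_on' with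
  | mem_mul_mem a ha l hl => exact ⟨⟨a, ha⟩ ⊗ₜ[k] ⟨l, hl⟩, by simp⟩
  | add x _ y _ hx hy =>
    obtain ⟨x, rfl⟩ := hx
    obtain ⟨y, rfl⟩ := hy
    exact ⟨x + y, map_add _ _ _⟩

variable {lam : Module.Dual k H}

theorem leftHit_comp_mulLeft_eq_smul_one (hlam : IsLeftCointegral lam)
    (hinf : A.toSubalgebra ⊓ L.toSubalgebra = ⊥) (a : A.toSubalgebra) (l : L.toSubalgebra) :
    leftHit (lam ∘ₗ LinearMap.mulLeft k (a : H)) (l : H) = lam (a * l) • 1 := by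
  have mem_A : leftHit (lam ∘ₗ LinearMap.mulLeft k (a : H)) (l : H) ∈ A.toSubalgebra :=
    Set.mem_of_eq_of_mem (hlam.leftHit_comp_mulLeft _ ((ℛ k a).induced A.subtypeBialgHom)) <|
      sum_mem fun i _ => A.toSubalgebra.smul_mem (A.antipode_mem _ (Subtype.prop _)) _
  have mem_L : leftHit (lam ∘ₗ LinearMap.mulLeft k (a : H)) (l : H) ∈ L.toSubalgebra :=
    Set.mem_of_eq_of_mem (map_leftHit (L.subtypeBialgHom : L.toSubalgebra →ₗc[k] H) _ l).symm
      (Subtype.prop _)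
  rw [eq_counit_smul_one_of_mem hinf mem_A mem_L, counit_leftHit, LinearMap.comp_apply,
    LinearMap.mulLeft_apply]

theorem leftHit_comp_mulBialgHom_tmul (hlam : IsLeftCointegral lam)
    (hinf : A.toSubalgebra ⊓ L.toSubalgebra = ⊥) (a : A.toSubalgebra) (l : L.toSubalgebra)
    {ι : Type*} (r : Repr k a ι) :
    leftHit (lam ∘ₗ (mulBialgHom hcomm : _ →ₗ[k] H)) (a ⊗ₜ[k] l) =
      (∑ i ∈ r.index, lam (r.right i * l) • r.left i) ⊗ₜ 1 := by
  have hleft (a : A.toSubalgebra) : leftHit ((lam ∘ₗ (mulBialgHom hcomm : _ →ₗ[k] H)) ∘ₗ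
      TensorProduct.mk k A.toSubalgebra L.toSubalgebra a) l = lam (a * l) • 1 :=
    Subtype.val_injective <|
      (map_leftHit (L.subtypeBialgHom : L.toSubalgebra →ₗc[k] H)
        (lam ∘ₗ LinearMap.mulLeft k (a : H)) l).trans
      (leftHit_comp_mulLeft_eq_smul_one hlam hinf a l)
  simp only [leftHit_tmul _ l r, hleft, TensorProduct.sum_tmul, TensorProduct.smul_tmul]

theorem isLeftCointegral_comp_mulBialgHom (hlam : IsLeftCointegral lam)
    (hinf : A.toSubalgebra ⊓ L.toSubalgebra = ⊥) :
    IsLeftCointegral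
      (lam ∘ₗ (mulBialgHom hcomm : A.toSubalgebra ⊗[k] L.toSubalgebra →ₗ[k] H)) := by
  intro x
  induction x with
  | zero => simp
  | add x y hx hy => simp only [map_add, hx, hy, add_smul]
  | tmul a l =>
    set y := ∑ i ∈ (ℛ k a).index, lam ((ℛ k a).right i * l) • (ℛ k a).left i
    have htmul : leftHit (lam ∘ₗ (mulBialgHom hcomm : _ →ₗ[k] H)) (a ⊗ₜ[k] l) = y ⊗ₜ 1 :=
      leftHit_comp_mulBialgHom_tmul hcomm hlam hinf a l (ℛ k a)
    have hy : y = lam (a * l) • 1 := by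
      refine Subtype.val_injective ?_
      calc (y : H) = mulBialgHom hcomm (y ⊗ₜ 1) := by simp
        _ = leftHit lam (mulBialgHom hcomm (a ⊗ₜ[k] l)) := by
          rw [← htmul]
          exact map_leftHit (mulBialgHom hcomm : A.toSubalgebra ⊗[k] L.toSubalgebra →ₗc[k] H) lam _
        _ = lam (a * l) • 1 := by rw [hlam, mulBialgHom_tmul]
    rw [htmul, hy, ← TensorProduct.smul_tmul', ← Algebra.TensorProduct.one_def]
    simp

theorem mulBialgHom_injective (hlam : IsLeftCointegral lam) (hne : lam ≠ 0)
    (hAL : Subalgebra.toSubmodule A.toSubalgebra * Subalgebra.toSubmodule L.toSubalgebra = ⊤)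
    (hinf : A.toSubalgebra ⊓ L.toSubalgebra = ⊥) : Function.Injective (mulBialgHom hcomm) := by
  refine (injective_iff_map_eq_zero _).2 fun x hx => ?_
  refine (isLeftCointegral_comp_mulBialgHom hcomm hlam hinf).eq_zero_of_forall_apply_mul_eq_zero
    (fun h => hne ?_) fun s => by simp [hx]
  ext y
  obtain ⟨z, rfl⟩ := mulBialgHom_surjective hcomm hAL y
  exact congr($h z)

end mulBialgHom

end HopfSubalgebra

end

theorem theorem3p5_general {k H : Type*} [Field k] [Ring H] [HopfAlgebra k H]
    {lam : Module.Dual k H} (hlam : IsLeftCointegral lam) (hne : lam ≠ 0)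
    (A L : HopfSubalgebra k H) (hA : A.IsNormal) (hL : L.IsNormal)
    (hAL : Subalgebra.toSubmodule A.toSubalgebra * Subalgebra.toSubmodule L.toSubalgebra = ⊤)
    (hinf : A.toSubalgebra ⊓ L.toSubalgebra = ⊥) :
    ∃ φ : (A.toSubalgebra ⊗[k] L.toSubalgebra) ≃ₐc[k] H,
      (∀ (a : A.toSubalgebra) (l : L.toSubalgebra), φ (a ⊗ₜ[k] l) = (a : H) * (l : H)) ∧
      ∀ x : A.toSubalgebra ⊗[k] L.toSubalgebra,
        φ (HopfAlgebra.antipode k x) = HopfAlgebra.antipode k (φ x) := by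
  have hcomm := HopfSubalgebra.commute_of_isNormal hA hL hinf
  let φ := HopfSubalgebra.mulBialgHom hcomm
  have hφ : Function.Bijective φ :=
    ⟨HopfSubalgebra.mulBialgHom_injective hcomm hlam hne hAL hinf,
      HopfSubalgebra.mulBialgHom_surjective hcomm hAL⟩
  exact ⟨BialgEquiv.ofBijective φ hφ, HopfSubalgebra.mulBialgHom_tmul hcomm, map_antipode φ⟩

theorem theorem3p5 {k H : Type*} [Field k] [IsAlgClosed k] [CharZero k]
    [Ring H] [HopfAlgebra k H] [IsSemisimpleRing H]
    (A L : HopfSubalgebra k H) (hA : A.IsNormal) (hL : L.IsNormal)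
    (hAL : Subalgebra.toSubmodule A.toSubalgebra * Subalgebra.toSubmodule L.toSubalgebra = ⊤)
    (hinf : A.toSubalgebra ⊓ L.toSubalgebra = ⊥) :
    ∃ φ : (A.toSubalgebra ⊗[k] L.toSubalgebra) ≃ₐc[k] H,
      (∀ (a : A.toSubalgebra) (l : L.toSubalgebra), φ (a ⊗ₜ[k] l) = (a : H) * (l : H)) ∧
      ∀ x : A.toSubalgebra ⊗[k] L.toSubalgebra,
        φ (HopfAlgebra.antipode k x) = HopfAlgebra.antipode k (φ x) := by
  obtain ⟨t, ht, ht_ne⟩ := exists_isLeftIntegral_ne_zero k H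
  obtain ⟨lam, hlam, hne⟩ := ht.exists_isLeftCointegral_ne_zero ht_ne
  exact theorem3p5_general hlam hne A L hA hL hAL hinf
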